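/- **Theorem (LMI characterization of FIR approximation).** All systems are real, single-input single-output, discrete-time. Let $W(z)=C_W(zI-A_W)^{-1}B_W+D_W$ (weight) and $K(z)=C_K(zI-A_K)^{-1}B_K+D_K$ (given IIR filter) be stable realizations, i.e. all eigenvalues of $A_W$ and $A_K$ lie in the open unit disc. For $N\ge 0$ and $\alpha=(a_N,\dots,a_0)\in\mathbb{R}^{N+1}$ let $$K_f(z)=\sum_{k=0}^N a_kz^{-k},\qquad T_{ew}(z)=(K_f(z)-K(z))W(z),$$ and let $$\|T_{ew}\|_\infty=\sup_{w\in \ell^2,\,w\ne0}\frac{\|T_{ew}w\|_2}{\|w\|_2}$$ be its $\ell^2$-induced norm, where $T_{ew}w$ is the output of the system with transfer function $T_{ew}$, started at rest, for the input $w=(w[k])_{k\ge0}$. Let $A_f\in\mathbb{R}^{N\times N}$ be the matrix with ones on the first superdiagonal and zeros elsewhere, $B_f=[0,\dots,0,1]^T\in\mathbb{R}^{N}$, $C_f(\alpha)=[a_N,a_{N-1},\dots,a_1]$, $D_f(\alpha)=a_0$, and $$A=\begin{bmatrix}A_W&0&0\\B_KC_W&A_K&0\\B_fC_W&0&A_f\end{bmatrix},\quad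 B=\begin{bmatrix}B_W\\B_KD_W\\B_fD_W\end{bmatrix},$$ $$C(\alpha)=\begin{bmatrix}(D_f(\alpha)-D_K)C_W&-C_K&C_f(\alpha)\end{bmatrix},\quad D(\alpha)=(D_f(\alpha)-D_K)D_W .$$ Then: 1. For every $\alpha$, $K_f(z)=C_f(\alpha)(zI-A_f)^{-1}B_f+D_f(\alpha)$ and $T_{ew}(z)=C(\alpha)(zI-A)^{-1}B+D(\alpha)$ as rational functions. The matrices $A$ and $B$ do not depend on $\alpha$, and $C(\alpha)$ and $D(\alpha)$ are affine in $\alpha$. 2. For every $\gamma>0$ and every $\alpha$, $\|T_{ew}\|_\infty<\gamma$ if and only if there is a real symmetric matrix $P>0$ such that $$\begin{bmatrix}A^TPA-P&A^TPB&C(\alpha)^T\\B^TPA&-\gamma I+B^TPB&D(\alpha)^T\\C(\alpha)&D(\alpha)&-\gamma I\end{bmatrix}<0 .$$ 3. For every $\gamma>0$ the matrix on the left-hand side in 2 is jointly affine in $(P,\alpha)$. -/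

import Mathlib

open scoped ENNReal

noncomputable section

/-- A real single-input single-output discrete-time state-space realization
`x[k+1] = A x[k] + B u[k]`, `y[k] = C x[k] + D u[k]`, with states indexed by `n`. -/
structure Realization (n : Type*) where
  A : Matrix n n ℝ
  B : Matrix n (Fin 1) ℝ
  C : Matrix (Fin 1) n ℝ
  D : Matrix (Fin 1) (Fin 1) ℝ

namespace Realization

variable {n : Type*} [Fintype n] [DecidableEq n]

/-- The transfer function `C (z I - A)⁻¹ B + D`, a rational function of `z` (here `RatFunc.X`). -/
def transferFunction (S : Realization n) : RatFunc ℝ :=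
  (S.C.map RatFunc.C * (Matrix.scalar n RatFunc.X - S.A.map RatFunc.C)⁻¹ * S.B.map RatFunc.C
    + S.D.map RatFunc.C : Matrix (Fin 1) (Fin 1) (RatFunc ℝ)) 0 0

/-- Schur stability: all complex eigenvalues of `A` lie in the open unit disc. -/
def IsStable (S : Realization n) : Prop :=
  ∀ μ ∈ spectrum ℂ (S.A.map (algebraMap ℝ ℂ)), ‖μ‖ < 1

end Realization

/-- The impulse response (Markov parameters) of a proper rational transfer function `H(z)`: the
coefficients of its expansion in powers of `z⁻¹`. The expansion is the evaluation of `H`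
at `z = T⁻¹` in the field of Laurent series in `T`. -/
def impulseResponse (H : RatFunc ℝ) (k : ℕ) : ℝ :=
  (RatFunc.eval (HahnSeries.C : ℝ →+* LaurentSeries ℝ) (HahnSeries.single (-1 : ℤ) (1 : ℝ))
    H).coeff (k : ℤ)

/-- The output signal of the system with transfer function `H` and input `w`, started at rest. -/
def systemOutput (H : RatFunc ℝ) (w : ℕ → ℝ) (k : ℕ) : ℝ :=
  ∑ j ∈ Finset.range (k + 1), impulseResponse H (k - j) * w j

/-- The `ℓ²` norm of a signal, infinite if the signal is not square summable. -/
def l2Norm (u : ℕ → ℝ) : ℝ≥0∞ :=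
  (∑' k, ‖u k‖ₑ ^ 2) ^ (1 / 2 : ℝ)

/-- The `H^∞` norm of a transfer function, as its `ℓ²`-induced norm (possibly infinite). -/
def hInfNorm (H : RatFunc ℝ) : ℝ≥0∞ :=
  ⨆ (w : ℕ → ℝ) (_ : l2Norm w < ∞) (_ : w ≠ 0), l2Norm (systemOutput H w) / l2Norm w

/-- The FIR filter `K_f(z) = ∑_{k=0}^N a_k z^{-k}` with coefficients `α k = a_k`. -/
def firFilter {N : ℕ} (α : Fin (N + 1) → ℝ) : RatFunc ℝ :=
  ∑ k : Fin (N + 1), RatFunc.C (α k) * (RatFunc.X⁻¹) ^ (k : ℕ)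

/-- The shift-register realization of the FIR filter: ones on the superdiagonal of `A_f`,
`B_f = (0, …, 0, 1)ᵀ`, `C_f(α) = (a_N, a_{N-1}, …, a_1)` and `D_f(α) = a_0`. -/
def firRealization {N : ℕ} (α : Fin (N + 1) → ℝ) : Realization (Fin N) where
  A := Matrix.of fun i j => if (i : ℕ) + 1 = j then 1 else 0
  B := Matrix.of fun i _ => if (i : ℕ) + 1 = N then 1 else 0
  C := Matrix.of fun _ i => α ⟨N - i, by omega⟩
  D := Matrix.of fun _ _ => α 0

section ErrorSystem

variable {nW nK : Type*} [Fintype nW] [DecidableEq nW] [Fintype nK] [DecidableEq nK] {N : ℕ}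

/-- The transfer function from `w` to `e` in the error system: `w` is filtered by `W`, the result
goes through `K` and `K_f` in parallel, and `e` is the difference of their outputs. -/
def errorTransfer (W : Realization nW) (K : Realization nK) (α : Fin (N + 1) → ℝ) : RatFunc ℝ :=
  (firFilter α - K.transferFunction) * W.transferFunction

/-- The realization of the error system with states `(x_W, x_K, x_f)`. -/
def errorRealization (W : Realization nW) (K : Realization nK) (α : Fin (N + 1) → ℝ) :
    Realization (nW ⊕ (nK ⊕ Fin N)) where
  A := Matrix.fromBlocks
    W.A                                                       0
    (Matrix.fromRows (K.B * W.C) ((firRealization α).B * W.C))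
      (Matrix.fromBlocks K.A 0 0 (firRealization α).A)
  B := Matrix.fromRows W.B (Matrix.fromRows (K.B * W.D) ((firRealization α).B * W.D))
  C := Matrix.fromCols (((firRealization α).D - K.D) * W.C)
    (Matrix.fromCols (-K.C) (firRealization α).C)
  D := ((firRealization α).D - K.D) * W.D

end ErrorSystem

/-- The bounded-real matrix
`[[AᵀPA - P, AᵀPB, Cᵀ], [BᵀPA, -γI + BᵀPB, Dᵀ], [C, D, -γI]]`. -/
def boundedRealMatrix {n : Type*} [Fintype n] (S : Realization n) (γ : ℝ) (P : Matrix n n ℝ) :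
    Matrix (n ⊕ (Fin 1 ⊕ Fin 1)) (n ⊕ (Fin 1 ⊕ Fin 1)) ℝ :=
  Matrix.fromBlocks
    (S.A.transpose * P * S.A - P)
    (Matrix.fromCols (S.A.transpose * P * S.B) S.C.transpose)
    (Matrix.fromRows (S.B.transpose * P * S.A) S.C)
    (Matrix.fromBlocks
      (-(γ • (1 : Matrix (Fin 1) (Fin 1) ℝ)) + S.B.transpose * P * S.B) S.D.transpose
      S.D (-(γ • (1 : Matrix (Fin 1) (Fin 1) ℝ))))

end

noncomputable section

/-! ### Transfer functions and impulse responses -/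

section Resolvent

variable {n : Type*} [Fintype n] [DecidableEq n]

/-! The core is the strict bounded real lemma, proved entirely in the time domain. Expanding the
transfer function at infinity identifies its impulse response with `D, CB, CAB, ...`, so
`systemOutput` is the output of the state recursion started at zero
(`systemOutput_transferFunction`). By causality, a norm below `γ` means one gain `g < γ` valid on
every finite horizon (`hInfNorm_lt_iff`).

Sufficiency: eliminating the last coordinate of the LMI gives a strict dissipation inequality with
storage `xᵀPx`; summing it along a trajectory from rest bounds the gain
(`exists_gain_lt_of_posDef`).

Necessity: let `V x` be the supremum, over horizons and inputs, of the supply `y²/γ + ε|x|² - (γ -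
ε)u²` summed from state `x`. Stability and the gap `g < γ` make `V` finite and `O(‖x‖²)` for small
`ε` (`exists_extraction_le`). As a supremum of jointly quadratic functionals, `V` obeys the
parallelogram law, hence `V x = xᵀPx` (`exists_symm_matrix_of_parallelogram`). The Bellman
inequality for `V` is the LMI, and the `ε` terms make it and `P` strictly definite
(`exists_posDef`).

The error system is block triangular with a nilpotent FIR block, so it inherits stability. The
realization identities follow by solving `zv = Av + B` explicitly, and affineness by entrywise
computation. -/

theorem det_scalar_X_sub_ne_zero (A : Matrix n n ℝ) :
    (Matrix.scalar n RatFunc.X - A.map RatFunc.C).det ≠ 0 := by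
  have h : Matrix.scalar n RatFunc.X - A.map RatFunc.C
      = A.charmatrix.map (algebraMap (Polynomial ℝ) (RatFunc ℝ)) := by
    ext i j
    by_cases hij : i = j
    · subst hij; simp [Matrix.charmatrix_apply_eq, RatFunc.algebraMap_X, RatFunc.algebraMap_C]
    · simp [RatFunc.algebraMap_C, hij]
  rw [h, ← RingHom.mapMatrix_apply, ← RingHom.map_det]
  exact (map_ne_zero_iff _ (RatFunc.algebraMap_injective ℝ)).2 A.charpoly_monic.ne_zero

theorem scalar_X_sub_mul (A : Matrix n n ℝ) (v : Matrix n (Fin 1) (RatFunc ℝ)) :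
    (Matrix.scalar n RatFunc.X - A.map RatFunc.C) * v
      = (RatFunc.X : RatFunc ℝ) • v - A.map RatFunc.C * v := by
  rw [Matrix.sub_mul, Matrix.scalar_apply, Matrix.smul_eq_diagonal_mul]

/-- Since `zI - A` is invertible over the field of rational functions, `v` must be the resolvent
column. Transfer functions can thus be computed by exhibiting `v`, with no matrix inverse to
evaluate. -/
theorem Realization.transferFunction_eq_of_smul_eq (S : Realization n)
    (v : Matrix n (Fin 1) (RatFunc ℝ))
    (hv : (RatFunc.X : RatFunc ℝ) • v = S.A.map RatFunc.C * v + S.B.map RatFunc.C) :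
    S.transferFunction
      = (S.C.map RatFunc.C * v + S.D.map RatFunc.C : Matrix (Fin 1) (Fin 1) _) 0 0 := by
  have hu : IsUnit (Matrix.scalar n RatFunc.X - S.A.map RatFunc.C).det :=
    (det_scalar_X_sub_ne_zero S.A).isUnit
  have hB : S.B.map RatFunc.C = (Matrix.scalar n RatFunc.X - S.A.map RatFunc.C) * v := by
    rw [scalar_X_sub_mul, hv, add_sub_cancel_left]
  rw [Realization.transferFunction, hB, Matrix.mul_assoc,
    Matrix.nonsing_inv_mul_cancel_left _ _ hu]

theorem Realization.exists_smul_eq (S : Realization n) :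
    ∃ v : Matrix n (Fin 1) (RatFunc ℝ),
      (RatFunc.X : RatFunc ℝ) • v = S.A.map RatFunc.C * v + S.B.map RatFunc.C := by
  refine ⟨(Matrix.scalar n RatFunc.X - S.A.map RatFunc.C)⁻¹ * S.B.map RatFunc.C, ?_⟩
  rw [← sub_eq_iff_eq_add', ← scalar_X_sub_mul,
    Matrix.mul_nonsing_inv_cancel_left _ _ (det_scalar_X_sub_ne_zero S.A).isUnit]

end Resolvent

/-! ### Realizations of the FIR filter and of the error system -/

theorem firRealization_transferFunction {N : ℕ} (α : Fin (N + 1) → ℝ) :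
    (firRealization α).transferFunction = firFilter α := by
  have hX : (RatFunc.X : RatFunc ℝ) ≠ 0 := RatFunc.X_ne_zero
  rw [Realization.transferFunction_eq_of_smul_eq _
    -- Register `i` holds the input delayed by `N - i` steps; the last one is delayed once.
    (Matrix.of fun (i : Fin N) _ => (RatFunc.X⁻¹ : RatFunc ℝ) ^ (N - (i : ℕ)))]
  · simp only [Matrix.add_apply, Matrix.mul_apply, firRealization, Matrix.map_apply,
      Matrix.of_apply, firFilter]
    rw [Fin.sum_univ_succ, add_comm]
    congr 1
    · simp
    · rw [← Equiv.sum_comp Fin.revPerm]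
      refine Finset.sum_congr rfl fun i _ => ?_
      have h1 : N - ((Fin.rev i : Fin N) : ℕ) = (i : ℕ) + 1 := by
        rw [Fin.val_rev]; omega
      simp only [Fin.revPerm_apply, h1, Fin.val_succ]
      rfl
  · ext i j
    simp only [Matrix.smul_apply, Matrix.add_apply, smul_eq_mul,
      Matrix.mul_apply, firRealization, Matrix.map_apply, Matrix.of_apply]
    by_cases hi : (i : ℕ) + 1 = N
    · rw [Finset.sum_eq_zero]
      · have : N - (i : ℕ) = 1 := by omega
        simp [this, hi, hX]
      · intro k _
        have : (i : ℕ) + 1 ≠ k := by omega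
        simp [this]
    · have hlt : (i : ℕ) + 1 < N := by omega
      rw [Finset.sum_eq_single ⟨(i : ℕ) + 1, hlt⟩]
      · have : N - (i : ℕ) = (N - ((i : ℕ) + 1)) + 1 := by omega
        simp only [hi, if_true, if_false, map_one, map_zero, one_mul]
        rw [this, pow_succ', mul_inv_cancel_left₀ hX, add_zero]
      · intro k _ hk
        have : (i : ℕ) + 1 ≠ k := fun h => hk (Fin.ext h.symm)
        simp [this]
      · simp

namespace Matrix

variable {l m n R : Type*}

theorem smul_fromRows [SMul R R] (c : R) (M : Matrix l n R) (M' : Matrix m n R) :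
    c • fromRows M M' = fromRows (c • M) (c • M') := by
  ext (i | i) j <;> rfl

theorem fromRows_add_fromRows [Add R] (M N : Matrix l n R) (M' N' : Matrix m n R) :
    fromRows M M' + fromRows N N' = fromRows (M + N) (M' + N') := by
  ext (i | i) j <;> rfl

theorem map_C_zero : (0 : Matrix l m ℝ).map (RatFunc.C : ℝ →+* RatFunc ℝ) = 0 := by
  ext; simp

end Matrix

theorem errorRealization_transferFunction {nW nK : Type*} [Fintype nW] [DecidableEq nW]
    [Fintype nK] [DecidableEq nK] {N : ℕ} (W : Realization nW) (K : Realization nK)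
    (α : Fin (N + 1) → ℝ) :
    (errorRealization W K α).transferFunction = errorTransfer W K α := by
  obtain ⟨vW, hW⟩ := W.exists_smul_eq
  obtain ⟨vK, hK⟩ := K.exists_smul_eq
  obtain ⟨vF, hF⟩ := (firRealization α).exists_smul_eq
  rw [errorTransfer, ← firRealization_transferFunction,
    Realization.transferFunction_eq_of_smul_eq _ vW hW,
    Realization.transferFunction_eq_of_smul_eq _ vK hK,
    Realization.transferFunction_eq_of_smul_eq _ vF hF]
  set Wt : Matrix (Fin 1) (Fin 1) (RatFunc ℝ) := W.C.map RatFunc.C * vW + W.D.map RatFunc.C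
    with hWt
  rw [Realization.transferFunction_eq_of_smul_eq _
    -- `K` and the FIR filter are driven by the output of `W`, so their state vectors are multiplied
    -- by the transfer function `Wt` of `W`.
    (Matrix.fromRows vW (Matrix.fromRows (vK * Wt) (vF * Wt)))]
  · have hneg : (-K.C).map RatFunc.C = -K.C.map (RatFunc.C : ℝ →+* RatFunc ℝ) := by
      ext; simp
    have h : ∀ M M' : Matrix (Fin 1) (Fin 1) (RatFunc ℝ), M 0 0 * M' 0 0 = (M * M') 0 0 := by
      simp [Matrix.mul_apply]
    rw [← Matrix.sub_apply, h]
    refine congrFun (congrFun ?_ 0) 0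
    simp only [errorRealization, Matrix.fromCols_map, Matrix.fromCols_mul_fromRows,
      Matrix.map_mul, Matrix.map_sub RatFunc.C (map_sub _), hneg]
    simp only [hWt, Matrix.add_mul, Matrix.mul_add, Matrix.sub_mul, Matrix.neg_mul,
      Matrix.mul_assoc]
    abel
  · simp only [errorRealization, Matrix.fromBlocks_map, Matrix.fromRows_map, Matrix.map_C_zero,
      Matrix.fromBlocks_mul_fromRows, Matrix.map_mul, Matrix.zero_mul, add_zero, zero_add,
      Matrix.smul_fromRows, hW, ← Matrix.smul_mul, hK, hF, Matrix.fromRows_add_fromRows,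
      Matrix.fromRows_mul]
    congr 2 <;> 
    · simp only [hWt, Matrix.add_mul, Matrix.mul_add, Matrix.mul_assoc]
      abel

/-! ### Expansion at infinity, Markov parameters and state trajectories -/

section ImpulseResponse

/-- The leading coefficient survives as the coefficient of `T ^ (-natDegree)`, which no other
monomial reaches. Injectivity is what lets the evaluation extend to fractions. -/
theorem eval₂_single_neg_one_injective :
    Function.Injective (Polynomial.eval₂RingHom (HahnSeries.C : ℝ →+* LaurentSeries ℝ)
      (HahnSeries.single (-1 : ℤ) (1 : ℝ))) := by
  rw [injective_iff_map_eq_zero]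
  intro p hp
  by_contra hne
  have hcoeff : ((Polynomial.eval₂RingHom (HahnSeries.C : ℝ →+* LaurentSeries ℝ)
      (HahnSeries.single (-1 : ℤ) (1 : ℝ))) p).coeff (-(p.natDegree : ℤ)) = p.leadingCoeff := by
    rw [Polynomial.coe_eval₂RingHom, Polynomial.eval₂_eq_sum_range, HahnSeries.coeff_sum,
      Finset.sum_eq_single p.natDegree]
    · simp [HahnSeries.single_pow]
    · intro k _ hk
      rw [HahnSeries.single_pow, HahnSeries.C_apply, HahnSeries.single_mul_single,
        HahnSeries.coeff_single_of_ne]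
      simp only [zero_add, nsmul_eq_mul, mul_neg, mul_one, ne_eq, neg_inj, Nat.cast_inj]
      exact fun h => hk h.symm
    · simp
  rw [hp] at hcoeff
  exact hne (Polynomial.leadingCoeff_eq_zero.1 (by simpa using hcoeff.symm))

/-- The expansion of rational functions in powers of `z⁻¹`, as a ring homomorphism. -/
def expansionAtInfinity : RatFunc ℝ →+* LaurentSeries ℝ :=
  RatFunc.liftRingHom (Polynomial.eval₂RingHom HahnSeries.C (HahnSeries.single (-1 : ℤ) (1 : ℝ)))
    (nonZeroDivisors_le_comap_nonZeroDivisors_of_injective _ eval₂_single_neg_one_injective)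

theorem impulseResponse_eq_coeff (H : RatFunc ℝ) (k : ℕ) :
    impulseResponse H k = (expansionAtInfinity H).coeff (k : ℤ) := by
  rw [expansionAtInfinity, RatFunc.liftRingHom_apply]
  rfl

theorem expansionAtInfinity_C (a : ℝ) :
    expansionAtInfinity (RatFunc.C a) = HahnSeries.C a := by
  simp [expansionAtInfinity, RatFunc.liftRingHom_C]

theorem expansionAtInfinity_X :
    expansionAtInfinity RatFunc.X = HahnSeries.single (-1 : ℤ) (1 : ℝ) := by
  simp [expansionAtInfinity, RatFunc.liftRingHom_X]

variable {n : Type*} [Fintype n] [DecidableEq n]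

/-- Both sides solve the same linear system over the field of Laurent series, whose matrix is
invertible; the right side is the Neumann series `∑ A^k B T^(k+1)`. -/
theorem Realization.expansion_resolvent (S : Realization n) (v : Matrix n (Fin 1) (RatFunc ℝ))
    (hv : (RatFunc.X : RatFunc ℝ) • v = S.A.map RatFunc.C * v + S.B.map RatFunc.C) (i : n) :
    expansionAtInfinity (v i 0) = HahnSeries.ofPowerSeries ℤ ℝ
      (PowerSeries.X * PowerSeries.mk fun k => (S.A ^ k * S.B) i 0) := by
  set M : Matrix n n (LaurentSeries ℝ) :=
    (Matrix.scalar n RatFunc.X - S.A.map RatFunc.C).map expansionAtInfinity with hM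
  have hdet : M.det ≠ 0 := by
    rw [hM, ← RingHom.mapMatrix_apply, ← RingHom.map_det]
    exact (map_ne_zero _).2 (det_scalar_X_sub_ne_zero S.A)
  have hMapp : ∀ (u : n → LaurentSeries ℝ) i, (M.mulVec u) i =
      HahnSeries.single (-1 : ℤ) (1 : ℝ) * u i - ∑ j, HahnSeries.C (S.A i j) * u j := by
    intro u i
    have : M = Matrix.scalar n (HahnSeries.single (-1 : ℤ) (1 : ℝ)) - S.A.map HahnSeries.C := by
      ext1 a b
      by_cases hab : a = b
      · subst hab
        simp [hM, expansionAtInfinity_X, expansionAtInfinity_C]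
      · simp [hM, expansionAtInfinity_C, hab]
    rw [this, Matrix.sub_mulVec]
    simp [Matrix.scalar_apply, Matrix.mulVec, dotProduct]
  have h1 : M.mulVec (fun i => expansionAtInfinity (v i 0)) = fun i => HahnSeries.C (S.B i 0) := by
    funext i
    have h := congrArg expansionAtInfinity (congrFun (congrFun hv i) 0)
    simp only [Matrix.smul_apply, Matrix.add_apply, Matrix.mul_apply, Matrix.map_apply,
      smul_eq_mul, map_add, map_mul, map_sum, expansionAtInfinity_X, expansionAtInfinity_C] at h
    rw [hMapp, h, add_sub_cancel_left]
  have h2 : M.mulVec (fun i => HahnSeries.ofPowerSeries ℤ ℝ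
      (PowerSeries.X * PowerSeries.mk fun k => (S.A ^ k * S.B) i 0))
        = fun i => HahnSeries.C (S.B i 0) := by
    funext i
    rw [hMapp, sub_eq_iff_eq_add]
    rw [map_mul, HahnSeries.ofPowerSeries_X, ← mul_assoc, HahnSeries.single_mul_single,
      neg_add_cancel, one_mul]
    have hone : (HahnSeries.single (0 : ℤ) (1 : ℝ)) = 1 := rfl
    rw [hone, one_mul]
    simp only [← HahnSeries.ofPowerSeries_C, ← map_mul, ← map_sum, ← map_add]
    congr 1
    ext k
    rcases k with _ | k
    · simp
    · simp only [PowerSeries.coeff_mk, map_add, map_sum, PowerSeries.coeff_C_mul,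
        PowerSeries.coeff_succ_X_mul, PowerSeries.coeff_C, Nat.succ_ne_zero, if_false, zero_add]
      rw [pow_succ', Matrix.mul_assoc, Matrix.mul_apply]
  have hinj := Matrix.mulVec_injective_iff_isUnit.2 ((Matrix.isUnit_iff_isUnit_det M).2 hdet.isUnit)
  exact congrFun (hinj (h1.trans h2.symm)) i

theorem Realization.impulseResponse_transferFunction (S : Realization n) (k : ℕ) :
    impulseResponse S.transferFunction k =
      if k = 0 then S.D 0 0 else (S.C * (S.A ^ (k - 1) * S.B)) 0 0 := by
  obtain ⟨v, hv⟩ := S.exists_smul_eq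
  rw [impulseResponse_eq_coeff, S.transferFunction_eq_of_smul_eq v hv]
  have : expansionAtInfinity
      ((S.C.map RatFunc.C * v + S.D.map RatFunc.C : Matrix (Fin 1) (Fin 1) _) 0 0) =
      HahnSeries.ofPowerSeries ℤ ℝ ((∑ i, PowerSeries.C (S.C 0 i) *
        (PowerSeries.X * PowerSeries.mk fun k => (S.A ^ k * S.B) i 0))
          + PowerSeries.C (S.D 0 0)) := by
    simp only [Matrix.add_apply, Matrix.mul_apply, Matrix.map_apply, map_add, map_sum, map_mul,
      expansionAtInfinity_C, S.expansion_resolvent v hv, HahnSeries.ofPowerSeries_C]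
  rw [this, HahnSeries.ofPowerSeries_apply_coeff]
  rcases k with _ | k
  · simp
  · simp only [map_add, map_sum, PowerSeries.coeff_C_mul, PowerSeries.coeff_succ_X_mul,
      PowerSeries.coeff_mk, PowerSeries.coeff_C, Nat.succ_ne_zero, if_false, add_zero,
      Nat.add_sub_cancel]
    rw [Matrix.mul_apply]

/-- The state trajectory of a realization from the initial state `x` under the input `w`. -/
def Realization.state (S : Realization n) (x : n → ℝ) (w : ℕ → ℝ) : ℕ → n → ℝ
  | 0 => x
  | k + 1 => S.A.mulVec (S.state x w k) + w k • fun i => S.B i 0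

/-- The output of a realization in the state `x` with current input `u`. -/
def Realization.output (S : Realization n) (x : n → ℝ) (u : ℝ) : ℝ :=
  S.C 0 ⬝ᵥ x + S.D 0 0 * u

theorem Realization.state_zero_eq_sum (S : Realization n) (w : ℕ → ℝ) (k : ℕ) :
    S.state 0 w k =
      ∑ j ∈ Finset.range k, w j • fun i => (S.A ^ (k - 1 - j) * S.B) i 0 := by
  induction k with
  | zero => rfl
  | succ k ih =>
    rw [Realization.state, ih, Finset.sum_range_succ, Matrix.mulVec_sum]
    congr 1
    · refine Finset.sum_congr rfl fun j hj => ?_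
      have hj' : k + 1 - 1 - j = (k - 1 - j) + 1 := by
        have := Finset.mem_range.1 hj; omega
      rw [Matrix.mulVec_smul, hj', pow_succ', Matrix.mul_assoc]
      rfl
    · simp

theorem Realization.systemOutput_transferFunction (S : Realization n) (w : ℕ → ℝ) (k : ℕ) :
    systemOutput S.transferFunction w k = S.output (S.state 0 w k) (w k) := by
  rw [systemOutput, Finset.sum_range_succ, S.impulseResponse_transferFunction, Realization.output,
    S.state_zero_eq_sum, dotProduct_sum]
  congr 1
  · refine Finset.sum_congr rfl fun j hj => ?_
    have hj := Finset.mem_range.1 hj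
    rw [S.impulseResponse_transferFunction, if_neg (by omega), dotProduct_smul, smul_eq_mul,
      mul_comm, Matrix.mul_apply, show k - j - 1 = k - 1 - j by omega]
    rfl
  · simp

end ImpulseResponse

/-! ### The induced norm as a finite-horizon gain -/

section InducedNorm

theorem l2Norm_sq (u : ℕ → ℝ) : l2Norm u ^ 2 = ∑' k, ‖u k‖ₑ ^ 2 := by
  rw [l2Norm, ← ENNReal.rpow_natCast, ← ENNReal.rpow_mul]
  norm_num

theorem sum_enorm_sq (u : ℕ → ℝ) (s : Finset ℕ) :
    ∑ k ∈ s, ‖u k‖ₑ ^ 2 = ENNReal.ofReal (∑ k ∈ s, u k ^ 2) := by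
  rw [ENNReal.ofReal_sum_of_nonneg fun _ _ => sq_nonneg _]
  refine Finset.sum_congr rfl fun k _ => ?_
  rw [← ofReal_norm, ← ENNReal.ofReal_pow (norm_nonneg _), Real.norm_eq_abs, sq_abs]

theorem l2Norm_ne_zero {u : ℕ → ℝ} (hu : u ≠ 0) : l2Norm u ≠ 0 := by
  intro h
  have h2 := l2Norm_sq u
  rw [h, zero_pow two_ne_zero, eq_comm, ENNReal.tsum_eq_zero] at h2
  exact hu (funext fun k => by simpa using h2 k)

/-- The signal `w` cut off at time `T`. -/
def cutoff (T : ℕ) (w : ℕ → ℝ) (k : ℕ) : ℝ := if k < T then w k else 0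

theorem l2Norm_sq_cutoff (T : ℕ) (w : ℕ → ℝ) :
    l2Norm (cutoff T w) ^ 2 = ENNReal.ofReal (∑ k ∈ Finset.range T, w k ^ 2) := by
  rw [l2Norm_sq, tsum_eq_sum (s := Finset.range T), sum_enorm_sq]
  · congr 1
    refine Finset.sum_congr rfl fun k hk => ?_
    rw [cutoff, if_pos (Finset.mem_range.1 hk)]
  · intro k hk
    rw [cutoff, if_neg (by simpa using hk)]
    simp

theorem systemOutput_cutoff (H : RatFunc ℝ) {T k : ℕ} (hk : k < T) (w : ℕ → ℝ) :
    systemOutput H (cutoff T w) k = systemOutput H w k := by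
  refine Finset.sum_congr rfl fun j hj => ?_
  rw [cutoff, if_pos (by have := Finset.mem_range.1 hj; omega)]

/-- By causality the output before time `T` sees only the input before `T`, so truncated inputs,
which have finite energy, suffice. The separate `g` keeps the inequality strict after taking the
supremum. -/
theorem hInfNorm_lt_iff (H : RatFunc ℝ) {γ : ℝ} (hγ : 0 < γ) :
    hInfNorm H < ENNReal.ofReal γ ↔ ∃ g, 0 ≤ g ∧ g < γ ∧ ∀ (w : ℕ → ℝ) (T : ℕ),
      ∑ k ∈ Finset.range T, systemOutput H w k ^ 2 ≤ g ^ 2 * ∑ k ∈ Finset.range T, w k ^ 2 := by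
  constructor
  · intro h
    have htop : hInfNorm H ≠ ∞ := (h.trans ENNReal.ofReal_lt_top).ne
    refine ⟨(hInfNorm H).toReal, ENNReal.toReal_nonneg, ?_, fun w T => ?_⟩
    · exact (ENNReal.lt_ofReal_iff_toReal_lt htop).1 h
    · have hfin : l2Norm (cutoff T w) < ∞ := by
        have : l2Norm (cutoff T w) ^ 2 < ∞ := by
          rw [l2Norm_sq_cutoff]; exact ENNReal.ofReal_lt_top
        exact (ENNReal.pow_lt_top_iff.1 this).resolve_right two_ne_zero
      have hle : l2Norm (systemOutput H (cutoff T w)) ≤ hInfNorm H * l2Norm (cutoff T w) := by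
        by_cases h0 : cutoff T w = 0
        · have : l2Norm (systemOutput H 0) = 0 := by
            simp [l2Norm, systemOutput]
          rw [h0, this]
          exact zero_le
        · rw [← ENNReal.div_le_iff (l2Norm_ne_zero h0) hfin.ne]
          exact le_iSup₂_of_le (cutoff T w) hfin (le_iSup_of_le h0 le_rfl)
      have hsq := pow_le_pow_left' hle 2
      rw [mul_pow, l2Norm_sq_cutoff, l2Norm_sq] at hsq
      have hsum := (ENNReal.sum_le_tsum (Finset.range T)).trans hsq
      rw [sum_enorm_sq, ← ENNReal.ofReal_toReal htop, ← ENNReal.ofReal_pow ENNReal.toReal_nonneg,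
        ← ENNReal.ofReal_mul (by positivity),
        ENNReal.ofReal_le_ofReal_iff
          (mul_nonneg (sq_nonneg _) (Finset.sum_nonneg fun _ _ => sq_nonneg _))] at hsum
      refine le_trans (le_of_eq (Finset.sum_congr rfl fun k hk => ?_)) hsum
      rw [systemOutput_cutoff H (Finset.mem_range.1 hk)]
  · rintro ⟨g, hg0, hg, hle⟩
    refine lt_of_le_of_lt ?_ ((ENNReal.ofReal_lt_ofReal_iff hγ).2 hg)
    refine iSup₂_le fun w hw => iSup_le fun hw0 => ?_
    rw [ENNReal.div_le_iff (l2Norm_ne_zero hw0) hw.ne,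
      ← ENNReal.pow_le_pow_left_iff two_ne_zero, mul_pow, l2Norm_sq, ENNReal.tsum_eq_iSup_nat]
    refine iSup_le fun T => ?_
    rw [sum_enorm_sq, ← ENNReal.ofReal_pow hg0]
    refine (ENNReal.ofReal_le_ofReal (hle w T)).trans ?_
    rw [ENNReal.ofReal_mul (by positivity), ← sum_enorm_sq, l2Norm_sq]
    gcongr
    exact ENNReal.sum_le_tsum _

end InducedNorm

/-! ### Energy bounds for stable systems -/

section Stability

variable {n : Type*} [Fintype n] [DecidableEq n]

attribute [local instance] Matrix.linftyOpNormedRing Matrix.linftyOpNormedAlgebra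

/-- Gelfand's formula: the complex spectral radius is below some `r < 1`, so `‖M ^ m‖ ≤ r ^ m` for
large `m`. The complex sup norm restricts to the real one on real vectors. -/
theorem Realization.IsStable.exists_norm_pow_mulVec_le {S : Realization n} (hS : S.IsStable) :
    ∃ m : ℕ, ∀ x : n → ℝ, ‖(S.A ^ m).mulVec x‖ ≤ 1 / 2 * ‖x‖ := by
  rcases isEmpty_or_nonempty n with hn | hn
  · exact ⟨0, fun x => by rw [Subsingleton.elim x 0]; simp⟩
  set M : Matrix n n ℂ := S.A.map (algebraMap ℝ ℂ) with hM
  have hr : spectralRadius ℂ M < (1 : NNReal) :=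
    spectrum.spectralRadius_lt_of_forall_lt M fun z hz => hS z hz
  obtain ⟨r, hr0, hr1⟩ := ENNReal.lt_iff_exists_nnreal_btwn.1 hr
  have hr1' : r < 1 := by exact_mod_cast hr1
  have hev := (spectrum.pow_nnnorm_pow_one_div_tendsto_nhds_spectralRadius M).eventually
    (gt_mem_nhds hr0)
  have hpow := (tendsto_pow_atTop_nhds_zero_of_lt_one r.coe_nonneg
    (by exact_mod_cast hr1' : (r : ℝ) < 1)).eventually
    (gt_mem_nhds (by norm_num : (0 : ℝ) < 1 / 2))
  obtain ⟨m, ⟨hm1, hm2⟩, hm0⟩ := ((hev.and hpow).and (Filter.eventually_gt_atTop 0)).exists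
  have hnorm : ‖M ^ m‖ ≤ 1 / 2 := by
    refine le_trans ?_ hm2.le
    have h := ENNReal.pow_le_pow_left hm1.le (n := m)
    rw [← ENNReal.rpow_natCast, ← ENNReal.rpow_mul, one_div_mul_cancel (by positivity),
      ENNReal.rpow_one] at h
    exact_mod_cast h
  refine ⟨m, fun x => ?_⟩
  have hmap : (M ^ m).mulVec (fun i => (x i : ℂ)) = fun i => (((S.A ^ m).mulVec x i : ℝ) : ℂ) := by
    funext i
    rw [hM, ← RingHom.mapMatrix_apply, ← map_pow]
    simp [Matrix.mulVec, dotProduct]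
  have hn : ∀ y : n → ℝ, ‖fun i => (y i : ℂ)‖ = ‖y‖ := fun y => by
    simp [Pi.norm_def, nnnorm, Complex.norm_real]
  rw [← hn, ← hmap, ← hn x]
  refine (Matrix.linfty_opNorm_mulVec _ _).trans ?_
  gcongr

/-- The square of `ρ a + b u = ρ a + (1 - ρ) (b u / (1 - ρ))` is bounded by convexity; the resulting
one-step inequality telescopes. -/
theorem sum_sq_le_of_contraction {a u : ℕ → ℝ} {ρ b : ℝ} (ha : ∀ k, 0 ≤ a k) (hρ0 : 0 ≤ ρ)
    (hρ1 : ρ < 1) (h : ∀ k, a (k + 1) ≤ ρ * a k + b * u k) (T : ℕ) :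
    (1 - ρ) * ∑ k ∈ Finset.range T, a k ^ 2 + a T ^ 2
      ≤ a 0 ^ 2 + b ^ 2 / (1 - ρ) * ∑ k ∈ Finset.range T, u k ^ 2 := by
  have h1 : 0 < 1 - ρ := by linarith
  induction T with
  | zero => simp
  | succ T ih =>
    rw [Finset.sum_range_succ, Finset.sum_range_succ]
    have h2 : a (T + 1) ^ 2 ≤ (ρ * a T + b * u T) ^ 2 := pow_le_pow_left₀ (ha _) (h T) 2
    have h3 : (ρ * a T + b * u T) ^ 2 ≤ ρ * a T ^ 2 + b ^ 2 / (1 - ρ) * u T ^ 2 := by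
      have : ρ * a T ^ 2 + b ^ 2 / (1 - ρ) * u T ^ 2 - (ρ * a T + b * u T) ^ 2
          = ρ / (1 - ρ) * ((1 - ρ) * a T - b * u T) ^ 2 := by
        field_simp
        ring
      have h4 : 0 ≤ ρ / (1 - ρ) * ((1 - ρ) * a T - b * u T) ^ 2 := by positivity
      linarith
    linarith

/-- The states of a stable system have energy bounded by that of the initial state and of the
input. -/
theorem Realization.IsStable.exists_sum_norm_sq_state_le {S : Realization n} (hS : S.IsStable) :
    ∃ c : ℝ, 0 ≤ c ∧ ∀ (x : n → ℝ) (w : ℕ → ℝ) (T : ℕ),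
      ∑ k ∈ Finset.range T, ‖S.state x w k‖ ^ 2
        ≤ c * (‖x‖ ^ 2 + ∑ k ∈ Finset.range T, w k ^ 2) := by
  obtain ⟨m, hm⟩ := hS.exists_norm_pow_mulVec_le
  -- An adapted norm: applying `A` shifts the sum, trading `‖x‖` for `‖A ^ m x‖ ≤ ‖x‖ / 2`. Together
  -- with `ν ≤ M‖·‖` this makes `A` a contraction with factor `1 - 1 / (2M)`.
  set ν : (n → ℝ) → ℝ := fun x => ∑ j ∈ Finset.range m, ‖(S.A ^ j).mulVec x‖ with hν
  have ν_nonneg : ∀ x, 0 ≤ ν x := fun x => Finset.sum_nonneg fun _ _ => norm_nonneg _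
  have ν_A : ∀ x, ν (S.A.mulVec x) ≤ ν x - 1 / 2 * ‖x‖ := by
    intro x
    have h1 : ν (S.A.mulVec x) + ‖x‖ = ν x + ‖(S.A ^ m).mulVec x‖ := by
      have := Finset.sum_range_succ' (fun j => ‖(S.A ^ j).mulVec x‖) m
      rw [Finset.sum_range_succ] at this
      simp only [hν, Matrix.mulVec_mulVec, ← pow_succ]
      simpa using this.symm
    linarith [hm x]
  have ν_add : ∀ x (t : ℝ) y, ν (x + t • y) ≤ ν x + |t| * ν y := by
    intro x t y
    simp only [hν, Finset.mul_sum, ← Finset.sum_add_distrib]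
    refine Finset.sum_le_sum fun j _ => ?_
    rw [Matrix.mulVec_add, Matrix.mulVec_smul, ← Real.norm_eq_abs, ← norm_smul]
    exact norm_add_le _ _
  -- The summand `1` gives `M ≥ 1`, which keeps the contraction factor nonnegative.
  set M : ℝ := 1 + ∑ j ∈ Finset.range m, ‖S.A ^ j‖ with hM
  have hM1 : 1 ≤ M := le_add_of_nonneg_right (Finset.sum_nonneg fun _ _ => norm_nonneg _)
  have ν_le : ∀ x, ν x ≤ M * ‖x‖ := by
    intro x
    rw [hM, add_mul, Finset.sum_mul]
    refine (Finset.sum_le_sum fun j _ => Matrix.linfty_opNorm_mulVec _ _).trans ?_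
    linarith [norm_nonneg x]
  set b : n → ℝ := fun i => S.B i 0 with hb
  have hρ0 : 0 ≤ 1 - 1 / (2 * M) := by
    rw [sub_nonneg, div_le_one (by linarith)]; linarith
  have hρ1 : 1 - 1 / (2 * M) < 1 := by
    have : 0 < 1 / (2 * M) := by positivity
    linarith
  have hsub : 1 - (1 - 1 / (2 * M)) = 1 / (2 * M) := by ring
  -- `4` comes from `‖x‖ ≤ 2 ν x`, the outer `2M` is `1 / (1 - ρ)`, and the bracket bounds the
  -- initial term and the input term `ν b ^ 2 / (1 - ρ)`.
  refine ⟨4 * (2 * M) * (M ^ 2 + ν b ^ 2 * (2 * M)), by positivity, fun x w T => ?_⟩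
  have hstep : ∀ k, ν (S.state x w (k + 1))
      ≤ (1 - 1 / (2 * M)) * ν (S.state x w k) + ν b * |w k| := by
    intro k
    have h1 := ν_add (S.A.mulVec (S.state x w k)) (w k) b
    have h2 := ν_A (S.state x w k)
    have h3 : 1 / (2 * M) * ν (S.state x w k) ≤ 1 / 2 * ‖S.state x w k‖ := by
      rw [one_div_mul_eq_div, div_le_iff₀ (by positivity)]
      linarith [ν_le (S.state x w k)]
    have h4 : ν (S.state x w (k + 1)) ≤ ν (S.A.mulVec (S.state x w k)) + |w k| * ν b := h1
    linarith
  have hsum := sum_sq_le_of_contraction (fun k => ν_nonneg (S.state x w k)) hρ0 hρ1 hstep T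
  simp only [sq_abs, hsub] at hsum
  have hx0 : ν (S.state x w 0) ^ 2 ≤ M ^ 2 * ‖x‖ ^ 2 := by
    rw [← mul_pow]
    exact pow_le_pow_left₀ (ν_nonneg _) (ν_le x) 2
  have hle : ∑ k ∈ Finset.range T, ‖S.state x w k‖ ^ 2
      ≤ 4 * ∑ k ∈ Finset.range T, ν (S.state x w k) ^ 2 := by
    rw [Finset.mul_sum]
    refine Finset.sum_le_sum fun k _ => ?_
    have h1 : ‖S.state x w k‖ ≤ 2 * ν (S.state x w k) := by
      linarith [ν_A (S.state x w k), ν_nonneg (S.A.mulVec (S.state x w k))]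
    have h2 := pow_le_pow_left₀ (norm_nonneg _) h1 2
    linarith
  set Eν := ∑ k ∈ Finset.range T, ν (S.state x w k) ^ 2
  set Ew := ∑ k ∈ Finset.range T, w k ^ 2
  have hEw : 0 ≤ Ew := Finset.sum_nonneg fun _ _ => sq_nonneg _
  have h5 : 1 / (2 * M) * Eν ≤ M ^ 2 * ‖x‖ ^ 2 + ν b ^ 2 * (2 * M) * Ew := by
    have : ν b ^ 2 / (1 / (2 * M)) = ν b ^ 2 * (2 * M) := by field_simp
    rw [this] at hsum
    linarith [sq_nonneg (ν (S.state x w T))]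
  rw [one_div_mul_eq_div, div_le_iff₀ (by positivity)] at h5
  refine hle.trans ?_
  have h6 : M ^ 2 * ‖x‖ ^ 2 + ν b ^ 2 * (2 * M) * Ew
      ≤ (M ^ 2 + ν b ^ 2 * (2 * M)) * (‖x‖ ^ 2 + Ew) := by
    have : 0 ≤ M ^ 2 * Ew + ν b ^ 2 * (2 * M) * ‖x‖ ^ 2 := by positivity
    linarith
  nlinarith [mul_le_mul_of_nonneg_right h6 (by positivity : (0 : ℝ) ≤ 2 * M)]

end Stability

/-- The characteristic polynomial factors over the diagonal blocks; the shift block is strictly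
upper triangular and contributes only the eigenvalue `0`. -/
theorem errorRealization_isStable {nW nK : Type*} [Fintype nW] [DecidableEq nW]
    [Fintype nK] [DecidableEq nK] {N : ℕ} {W : Realization nW} {K : Realization nK}
    (hW : W.IsStable) (hK : K.IsStable) (α : Fin (N + 1) → ℝ) :
    (errorRealization W K α).IsStable := by
  have hupper : ((firRealization α).A.map (algebraMap ℝ ℂ)).IsUpperTriangular := by
    intro i j hij
    have : (i : ℕ) + 1 ≠ j := by
      have : (j : ℕ) < i := hij
      omega
    simp [firRealization, this]
  have hdiag : ∀ i, (firRealization α).A.map (algebraMap ℝ ℂ) i i = 0 := fun i => by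
    simp [firRealization]
  intro μ hμ
  rw [Matrix.mem_spectrum_iff_isRoot_charpoly] at hμ
  simp only [errorRealization, Matrix.fromBlocks_map, Matrix.map_zero (algebraMap ℝ ℂ) (map_zero _),
    Matrix.charpoly_fromBlocks_zero₁₂, Matrix.charpoly_of_isUpperTriangular _ hupper, hdiag,
    Polynomial.IsRoot.def, Polynomial.eval_mul, mul_eq_zero] at hμ
  rcases hμ with h | h | h
  · exact hW μ (Matrix.mem_spectrum_iff_isRoot_charpoly.2 h)
  · exact hK μ (Matrix.mem_spectrum_iff_isRoot_charpoly.2 h)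
  · have : μ = 0 := by
      simp only [map_zero, sub_zero, Finset.prod_const, Polynomial.eval_pow,
        Polynomial.eval_X] at h
      exact eq_zero_of_pow_eq_zero h
    simp [this]

/-! ### Quadratic forms from the parallelogram law -/

section QuadraticForm

/-- Additivity removes integer parts: `m (f t - t f 1)` depends only on the fractional part of `m
t`, hence is bounded uniformly in `m`. -/
theorem AddMonoidHom.eq_mul_of_bounded_Icc (f : ℝ →+ ℝ) {K : ℝ}
    (hK : ∀ t, 0 ≤ t → t ≤ 1 → |f t| ≤ K) (t : ℝ) : f t = t * f 1 := by
  have key : ∀ m : ℕ, (m : ℝ) * |f t - t * f 1| ≤ 2 * K := by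
    intro m
    have h1 : (m : ℝ) * f t = ⌊(m : ℝ) * t⌋ * f 1 + f (Int.fract ((m : ℝ) * t)) := by
      have h2 : f ((m : ℝ) * t) = m * f t := by
        rw [← nsmul_eq_mul, map_nsmul, nsmul_eq_mul]
      have h3 : f (⌊(m : ℝ) * t⌋ : ℝ) = ⌊(m : ℝ) * t⌋ * f 1 := by
        rw [← zsmul_eq_mul, ← map_zsmul, zsmul_one]
      rw [← h2, ← h3, ← map_add, Int.floor_add_fract]
    have h4 : (m : ℝ) * (f t - t * f 1)
        = f (Int.fract ((m : ℝ) * t)) - Int.fract ((m : ℝ) * t) * f 1 := by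
      rw [mul_sub, h1, Int.fract]; ring
    have h5 := hK _ (Int.fract_nonneg ((m : ℝ) * t)) (Int.fract_lt_one _).le
    have h6 : |Int.fract ((m : ℝ) * t) * f 1| ≤ K := by
      rw [abs_mul, abs_of_nonneg (Int.fract_nonneg _)]
      have h7 := hK 1 zero_le_one le_rfl
      nlinarith [abs_nonneg (f 1), Int.fract_nonneg ((m : ℝ) * t), Int.fract_lt_one ((m : ℝ) * t)]
    rw [← Nat.abs_cast, ← abs_mul, h4]
    refine (abs_sub _ _).trans ?_
    linarith
  by_contra hne
  have hpos : 0 < |f t - t * f 1| := abs_pos.2 (sub_ne_zero.2 hne)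
  obtain ⟨m, hm⟩ := exists_nat_gt (2 * K / |f t - t * f 1|)
  rw [div_lt_iff₀ hpos] at hm
  exact absurd (key m) (not_le.2 hm)

/-- A nonnegative function that satisfies the parallelogram law and is quadratically bounded is a
quadratic form. -/
theorem exists_symm_matrix_of_parallelogram {n : Type*} [Fintype n] [DecidableEq n]
    (V : (n → ℝ) → ℝ) {c : ℝ} (h0 : ∀ x, 0 ≤ V x) (hc : ∀ x, V x ≤ c * ‖x‖ ^ 2)
    (hV : ∀ x y, V (x + y) + V (x - y) = 2 * V x + 2 * V y) :
    ∃ P : Matrix n n ℝ, P.IsHermitian ∧ ∀ x, V x = x ⬝ᵥ P.mulVec x := by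
  have hzero : V 0 = 0 := by
    have := hV 0 0
    simp only [add_zero, sub_zero] at this
    linarith
  have hthree : ∀ x y z, V (x + y + z) + V x + V y + V z = V (x + y) + V (x + z) + V (y + z) := by
    intro x y z
    have p1 := hV (x + y) z
    have p2 := hV (x + z) y
    have p3 := hV x (y - z)
    have p4 := hV y z
    rw [show x + z + y = x + y + z by abel] at p2
    rw [show x + (y - z) = x + y - z by abel, show x - (y - z) = x + z - y by abel] at p3
    linarith
  -- The Jordan–von Neumann argument: `hthree` makes the polarization biadditive, and the quadratic
  -- bound on `V` upgrades additivity to real homogeneity.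
  set B : (n → ℝ) → (n → ℝ) → ℝ := fun x y => (V (x + y) - V x - V y) / 2 with hB
  have hsymm : ∀ x y, B x y = B y x := fun x y => by simp only [hB, add_comm x y]; ring
  have hadd : ∀ x x' y, B (x + x') y = B x y + B x' y := by
    intro x x' y
    simp only [hB]
    linarith [hthree x x' y]
  have hsmul : ∀ (t : ℝ) x y, B (t • x) y = t * B x y := by
    intro t x y
    have hc0 : 0 ≤ |c| := abs_nonneg c
    let f : ℝ →+ ℝ := AddMonoidHom.mk' (fun t => B (t • x) y) fun s t => by
      rw [add_smul, hadd]
    have hf := f.eq_mul_of_bounded_Icc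
      (K := |c| * (‖x‖ + ‖y‖) ^ 2 + |c| * ‖x‖ ^ 2 + |c| * ‖y‖ ^ 2) ?_ t
    · simpa [f] using hf
    · intro s hs0 hs1
      have hV' : ∀ z r, ‖z‖ ≤ r → V z ≤ |c| * r ^ 2 := by
        intro z r hz
        refine (hc z).trans ((mul_le_mul_of_nonneg_right (le_abs_self c) (sq_nonneg _)).trans ?_)
        gcongr
      have hn : ‖s • x‖ ≤ ‖x‖ := by
        rw [norm_smul, Real.norm_eq_abs, abs_of_nonneg hs0]
        exact mul_le_of_le_one_left (norm_nonneg _) hs1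
      have h1 := hV' (s • x + y) (‖x‖ + ‖y‖) ((norm_add_le _ _).trans (by linarith))
      have h2 := hV' (s • x) ‖x‖ hn
      have h3 := hV' y ‖y‖ le_rfl
      have h4 := h0 (s • x + y)
      have h5 := h0 (s • x)
      have h6 := h0 y
      change |(V (s • x + y) - V (s • x) - V y) / 2| ≤ _
      rw [abs_le]
      constructor <;> linarith
  let L : (n → ℝ) →ₗ[ℝ] (n → ℝ) →ₗ[ℝ] ℝ := LinearMap.mk₂ ℝ B hadd hsmul
    (fun x y y' => by rw [hsymm, hadd, hsymm y, hsymm y'])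
    (fun t x y => by rw [hsymm, hsmul, hsymm y]; rfl)
  refine ⟨LinearMap.toMatrix₂' ℝ L, ?_, fun x => ?_⟩
  · ext i j
    simp only [Matrix.conjTranspose_apply, LinearMap.toMatrix₂'_apply, star_trivial]
    exact hsymm _ _
  · rw [← Matrix.toLinearMap₂'_apply', Matrix.toLinearMap₂'_toMatrix']
    change V x = (V (x + x) - V x - V x) / 2
    have := hV x x
    rw [sub_self, hzero] at this
    linarith

/-- The constant is the minimum of the form on the compact unit sphere; homogeneity does the rest.
-/
theorem Matrix.PosDef.exists_mul_norm_sq_le {n : Type*} [Fintype n] [Nonempty n] {M : Matrix n n ℝ}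
    (hM : M.PosDef) : ∃ ε : ℝ, 0 < ε ∧ ∀ z, ε * ‖z‖ ^ 2 ≤ z ⬝ᵥ M.mulVec z := by
  classical
  have hcont : Continuous fun z : n → ℝ => z ⬝ᵥ M.mulVec z := by
    simp only [dotProduct, Matrix.mulVec]
    fun_prop
  obtain ⟨z₀, hz₀, hmin⟩ := (isCompact_sphere (0 : n → ℝ) 1).exists_isMinOn
    (NormedSpace.sphere_nonempty.2 zero_le_one) hcont.continuousOn
  have hne : z₀ ≠ 0 := by
    rintro rfl
    simp at hz₀
  refine ⟨_, hM.dotProduct_mulVec_pos hne, fun z => ?_⟩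
  by_cases hz : z = 0
  · simp [hz]
  · have hz' : ‖z‖ ≠ 0 := norm_ne_zero_iff.2 hz
    have h1 : ‖z‖⁻¹ • z ∈ Metric.sphere (0 : n → ℝ) 1 := by
      simp [norm_smul, hz']
    have h2 := hmin h1
    simp only [Set.mem_ofPred_eq, Matrix.mulVec_smul, dotProduct_smul, smul_dotProduct,
      smul_eq_mul] at h2
    have h3 := mul_le_mul_of_nonneg_right h2 (sq_nonneg ‖z‖)
    have h4 : ‖z‖⁻¹ * (‖z‖⁻¹ * z ⬝ᵥ M.mulVec z) * ‖z‖ ^ 2 = z ⬝ᵥ M.mulVec z := by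
      field_simp
    rw [h4] at h3
    simpa using h3

end QuadraticForm

/-! ### The LMI as a dissipation inequality; sufficiency -/

section BoundedReal

theorem Matrix.dotProduct_transpose_mulVec_eq {l m : Type*} [Fintype l] [Fintype m]
    (M : Matrix l m ℝ) (a : m → ℝ) (b : l → ℝ) :
    a ⬝ᵥ M.transpose.mulVec b = M.mulVec a ⬝ᵥ b := by
  rw [Matrix.dotProduct_mulVec, Matrix.vecMul_transpose]

namespace Realization

variable {n : Type*} [Fintype n]

/-- The successor of the state `x` under the input `u`. -/
def next (S : Realization n) (x : n → ℝ) (u : ℝ) : n → ℝ :=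
  S.A.mulVec x + u • fun i => S.B i 0

theorem next_add (S : Realization n) (x y : n → ℝ) (u v : ℝ) :
    S.next (x + y) (u + v) = S.next x u + S.next y v := by
  simp only [next, Matrix.mulVec_add, add_smul]
  abel

theorem next_smul (S : Realization n) (t : ℝ) (x : n → ℝ) (u : ℝ) :
    S.next (t • x) (t * u) = t • S.next x u := by
  simp only [next, Matrix.mulVec_smul, smul_add, mul_smul]

theorem output_add (S : Realization n) (x y : n → ℝ) (u v : ℝ) :
    S.output (x + y) (u + v) = S.output x u + S.output y v := by
  simp only [output, dotProduct_add]
  ring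

theorem output_smul (S : Realization n) (t : ℝ) (x : n → ℝ) (u : ℝ) :
    S.output (t • x) (t * u) = t * S.output x u := by
  simp only [output, dotProduct_smul, smul_eq_mul]
  ring

theorem dotProduct_boundedRealMatrix_mulVec (S : Realization n) (γ : ℝ) (P : Matrix n n ℝ)
    (x : n → ℝ) (u e : ℝ) :
    (Sum.elim x (Sum.elim (fun _ => u) fun _ => e)) ⬝ᵥ (boundedRealMatrix S γ P).mulVec
        (Sum.elim x (Sum.elim (fun _ => u) fun _ => e)) =
      S.next x u ⬝ᵥ P.mulVec (S.next x u) - x ⬝ᵥ P.mulVec x - γ * u ^ 2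
        + 2 * e * S.output x u - γ * e ^ 2 := by
  have hB : ∀ t : ℝ, S.B.mulVec (fun _ => t) = t • fun i => S.B i 0 := by
    intro t; ext i; simp [Matrix.mulVec, dotProduct, mul_comm]
  have hC : ∀ t : ℝ, S.C.transpose.mulVec (fun _ => t) = t • S.C 0 := by
    intro t; ext i; simp [Matrix.mulVec, dotProduct, mul_comm]
  have hCx : (fun _ => e : Fin 1 → ℝ) ⬝ᵥ S.C.mulVec x = e * (S.C 0 ⬝ᵥ x) := by
    simp [Matrix.mulVec, dotProduct]
  have hD : ∀ a b : ℝ, (fun _ => a : Fin 1 → ℝ) ⬝ᵥ S.D.mulVec (fun _ => b) = a * (S.D 0 0 * b) := by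
    simp [Matrix.mulVec, dotProduct]
  have hDT : ∀ a b : ℝ, (fun _ => a : Fin 1 → ℝ) ⬝ᵥ S.D.transpose.mulVec (fun _ => b)
      = a * (S.D 0 0 * b) := by
    simp [Matrix.mulVec, dotProduct]
  have hone : ∀ a : ℝ, (fun _ => a : Fin 1 → ℝ) ⬝ᵥ (fun _ => a) = a ^ 2 := by
    simp [dotProduct, sq]
  simp only [boundedRealMatrix, Matrix.fromBlocks_mulVec, Sum.elim_comp_inl, Sum.elim_comp_inr,
    Matrix.fromCols_mulVec_sumElim, Matrix.fromRows_mulVec, sumElim_dotProduct_sumElim,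
    Matrix.sub_mulVec, Matrix.add_mulVec, Matrix.neg_mulVec, Matrix.smul_mulVec, Matrix.one_mulVec,
    ← Matrix.mulVec_mulVec, dotProduct_add, dotProduct_sub, dotProduct_neg, dotProduct_smul,
    Matrix.dotProduct_transpose_mulVec_eq, hB,
    hC, hCx, hD, hDT, hone, smul_eq_mul]
  simp only [next, output, Matrix.mulVec_add, Matrix.mulVec_smul, dotProduct_add, add_dotProduct,
    dotProduct_smul, smul_dotProduct, smul_eq_mul, dotProduct_comm x (S.C 0)]
  ring

theorem isHermitian_boundedRealMatrix (S : Realization n) (γ : ℝ) {P : Matrix n n ℝ}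
    (hP : P.IsHermitian) : (boundedRealMatrix S γ P).IsHermitian := by
  have hP' : P.transpose = P := by simpa [Matrix.IsHermitian] using hP
  have hD : ∀ D : Matrix (Fin 1) (Fin 1) ℝ, D.transpose = D := fun D => by
    ext i j; rw [Subsingleton.elim i j]; rfl
  rw [Matrix.IsHermitian, Matrix.conjTranspose_eq_transpose_of_trivial]
  simp only [boundedRealMatrix, Matrix.fromBlocks_transpose, Matrix.transpose_fromCols,
    Matrix.transpose_fromRows, Matrix.transpose_sub, Matrix.transpose_mul,
    Matrix.transpose_transpose, hP', hD, Matrix.mul_assoc]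

/-- The bounded-real matrix is negative definite if and only if its quadratic form is. -/
theorem posDef_neg_boundedRealMatrix_iff (S : Realization n) (γ : ℝ) {P : Matrix n n ℝ}
    (hP : P.IsHermitian) : (-boundedRealMatrix S γ P).PosDef ↔ ∀ (x : n → ℝ) (u e : ℝ),
      (x ≠ 0 ∨ u ≠ 0 ∨ e ≠ 0) → S.next x u ⬝ᵥ P.mulVec (S.next x u) - x ⬝ᵥ P.mulVec x
        - γ * u ^ 2 + 2 * e * S.output x u - γ * e ^ 2 < 0 := by
  rw [Matrix.posDef_iff_dotProduct_mulVec, and_iff_right (S.isHermitian_boundedRealMatrix γ hP).neg]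
  simp only [star_trivial, Matrix.neg_mulVec, dotProduct_neg, Left.neg_pos_iff]
  constructor
  · intro h x u e hne
    rw [← dotProduct_boundedRealMatrix_mulVec]
    refine h fun h0 => ?_
    have hx : x = 0 := funext fun i => congrFun h0 (Sum.inl i)
    have hu : u = 0 := congrFun h0 (Sum.inr (Sum.inl 0))
    have he : e = 0 := congrFun h0 (Sum.inr (Sum.inr 0))
    tauto
  · intro h z hz
    have hz' : z = Sum.elim (z ∘ Sum.inl) (Sum.elim (fun _ => z (Sum.inr (Sum.inl 0)))
        fun _ => z (Sum.inr (Sum.inr 0))) := by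
      ext (i | i | i)
      · rfl
      · rw [Subsingleton.elim i 0]; rfl
      · rw [Subsingleton.elim i 0]; rfl
    rw [hz', dotProduct_boundedRealMatrix_mulVec]
    refine h _ _ _ ?_
    by_contra! hcon
    refine hz ?_
    rw [hz', hcon.1, hcon.2.1, hcon.2.2]
    ext (i | i | i) <;> rfl

theorem state_succ (S : Realization n) (x : n → ℝ) (w : ℕ → ℝ) (k : ℕ) :
    S.state x w (k + 1) = S.next (S.state x w k) (w k) := rfl

/-- A feasible matrix inequality bounds the gain of the system. -/
theorem exists_gain_lt_of_posDef (S : Realization n) {γ : ℝ} (hγ : 0 < γ) {P : Matrix n n ℝ}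
    (hP : P.PosDef) (hM : (-boundedRealMatrix S γ P).PosDef) :
    ∃ g, 0 ≤ g ∧ g < γ ∧ ∀ (w : ℕ → ℝ) (T : ℕ),
      ∑ k ∈ Finset.range T, S.output (S.state 0 w k) (w k) ^ 2
        ≤ g ^ 2 * ∑ k ∈ Finset.range T, w k ^ 2 := by
  obtain ⟨ε, hε, hle⟩ := hM.exists_mul_norm_sq_le
  have hstep : ∀ (x : n → ℝ) (u : ℝ), S.output x u ^ 2 / γ + S.next x u ⬝ᵥ P.mulVec (S.next x u)
      - x ⬝ᵥ P.mulVec x ≤ (γ - min ε γ) * u ^ 2 := by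
    intro x u
    set z : n ⊕ (Fin 1 ⊕ Fin 1) → ℝ :=
      -- The choice `e = y / γ` maximizes `2 e y - γ e²`, with value `y² / γ`: the Schur complement
      -- step.
      Sum.elim x (Sum.elim (fun _ => u) fun _ => S.output x u / γ) with hz
    have h1 := hle z
    rw [Matrix.neg_mulVec, dotProduct_neg, hz, dotProduct_boundedRealMatrix_mulVec, ← hz] at h1
    have h2 : |u| ≤ ‖z‖ := by
      simpa [hz] using norm_le_pi_norm z (Sum.inr (Sum.inl 0))
    have h3 : min ε γ * u ^ 2 ≤ ε * ‖z‖ ^ 2 := by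
      rw [← sq_abs u]
      gcongr
      exact min_le_left _ _
    have h4 : 2 * (S.output x u / γ) * S.output x u - γ * (S.output x u / γ) ^ 2
        = S.output x u ^ 2 / γ := by
      field_simp
      ring
    linarith
  have hmin : 0 < min ε γ := lt_min hε hγ
  have hnn : 0 ≤ γ * (γ - min ε γ) := mul_nonneg hγ.le (sub_nonneg.2 (min_le_right _ _))
  -- The margin is `min ε γ` rather than `ε` so that the radicand is nonnegative.
  refine ⟨√(γ * (γ - min ε γ)), Real.sqrt_nonneg _, ?_, fun w T => ?_⟩
  · rw [Real.sqrt_lt' hγ, sq]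
    exact mul_lt_mul_of_pos_left (by linarith) hγ
  · rw [Real.sq_sqrt hnn]
    have htel : ∀ T, (∑ k ∈ Finset.range T, S.output (S.state 0 w k) (w k) ^ 2) / γ
        + S.state 0 w T ⬝ᵥ P.mulVec (S.state 0 w T)
        ≤ (γ - min ε γ) * ∑ k ∈ Finset.range T, w k ^ 2 := by
      intro T
      induction T with
      | zero => simp [state]
      | succ T ih =>
        rw [Finset.sum_range_succ, Finset.sum_range_succ, state_succ, add_div]
        linarith [hstep (S.state 0 w T) (w T)]
    have hpos : 0 ≤ S.state 0 w T ⬝ᵥ P.mulVec (S.state 0 w T) := by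
      simpa using hP.posSemidef.dotProduct_mulVec_nonneg (S.state 0 w T)
    have h := htel T
    have h' : (∑ k ∈ Finset.range T, S.output (S.state 0 w k) (w k) ^ 2) / γ
        ≤ (γ - min ε γ) * ∑ k ∈ Finset.range T, w k ^ 2 := by linarith
    rw [div_le_iff₀ hγ] at h'
    linarith

end Realization

end BoundedReal

/-! ### Available storage; necessity -/

section Storage

namespace Realization

variable {n : Type*} [Fintype n]

/-- The supply at one time step, with a penalty `ε` on the state and on the input. -/
def supply (S : Realization n) (γ ε : ℝ) (x : n → ℝ) (u : ℝ) : ℝ :=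
  S.output x u ^ 2 / γ + ε * (x ⬝ᵥ x) - (γ - ε) * u ^ 2

/-- The supply extracted over the horizon `T` from the initial state `x` with the input `w`. -/
def extraction (S : Realization n) (γ ε : ℝ) : ℕ → (n → ℝ) → (ℕ → ℝ) → ℝ
  | 0, _, _ => 0
  | T + 1, x, w => S.supply γ ε x (w 0) + S.extraction γ ε T (S.next x (w 0)) fun k => w (k + 1)

theorem supply_smul (S : Realization n) (γ ε t : ℝ) (x : n → ℝ) (u : ℝ) :
    S.supply γ ε (t • x) (t * u) = t ^ 2 * S.supply γ ε x u := by
  simp only [supply, output_smul, dotProduct_smul, smul_dotProduct, smul_eq_mul]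
  ring

theorem supply_parallelogram (S : Realization n) (γ ε : ℝ) (x y : n → ℝ) (u v : ℝ) :
    S.supply γ ε (x + y) (u + v) + S.supply γ ε (x - y) (u - v)
      = 2 * S.supply γ ε x u + 2 * S.supply γ ε y v := by
  have h1 : S.output (x - y) (u - v) = S.output x u - S.output y v := by
    simp only [output, dotProduct_sub]; ring
  simp only [supply, output_add, h1, dotProduct_add, add_dotProduct, dotProduct_sub,
    sub_dotProduct]
  ring

theorem extraction_smul (S : Realization n) (γ ε t : ℝ) (T : ℕ) (x : n → ℝ) (w : ℕ → ℝ) :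
    S.extraction γ ε T (t • x) (t • w) = t ^ 2 * S.extraction γ ε T x w := by
  induction T generalizing x w with
  | zero => simp [extraction]
  | succ T ih =>
    have h := ih (S.next x (w 0)) fun k => w (k + 1)
    rw [← next_smul] at h
    simp only [extraction, Pi.smul_apply, smul_eq_mul, supply_smul, mul_add]
    rw [← h]
    rfl

/-- On a fixed horizon the dynamics are linear and the supply is quadratic, so the extraction is a
quadratic form in state and input jointly. -/
theorem extraction_parallelogram (S : Realization n) (γ ε : ℝ) (T : ℕ) (x y : n → ℝ)
    (w v : ℕ → ℝ) :
    S.extraction γ ε T (x + y) (w + v) + S.extraction γ ε T (x - y) (w - v)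
      = 2 * S.extraction γ ε T x w + 2 * S.extraction γ ε T y v := by
  induction T generalizing x y w v with
  | zero => simp [extraction]
  | succ T ih =>
    have h := ih (S.next x (w 0)) (S.next y (v 0)) (fun k => w (k + 1)) fun k => v (k + 1)
    have h1 : S.next (x - y) (w 0 - v 0) = S.next x (w 0) - S.next y (v 0) := by
      simp only [next, Matrix.mulVec_sub, sub_smul]
      abel
    rw [← next_add, ← h1] at h
    have h2 := S.supply_parallelogram γ ε x y (w 0) (v 0)
    simp only [extraction, Pi.add_apply, Pi.sub_apply]
    change S.supply γ ε (x + y) (w 0 + v 0) + S.extraction γ ε T _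
        ((fun k => w (k + 1)) + fun k => v (k + 1))
      + (S.supply γ ε (x - y) (w 0 - v 0) + S.extraction γ ε T _
        ((fun k => w (k + 1)) - fun k => v (k + 1))) = _
    linarith

theorem mul_dotProduct_self_le_supply_zero (S : Realization n) {γ : ℝ} (hγ : 0 < γ) (ε : ℝ)
    (x : n → ℝ) :
    ε * (x ⬝ᵥ x) ≤ S.supply γ ε x 0 := by
  have : 0 ≤ S.output x 0 ^ 2 / γ := by positivity
  simp only [supply]
  linarith

theorem dotProduct_self_nonneg (x : n → ℝ) : 0 ≤ x ⬝ᵥ x :=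
  Finset.sum_nonneg fun _ _ => mul_self_nonneg _

theorem extraction_zero_nonneg (S : Realization n) {γ ε : ℝ} (hγ : 0 < γ) (hε : 0 < ε) (T : ℕ)
    (x : n → ℝ) : 0 ≤ S.extraction γ ε T x 0 := by
  induction T generalizing x with
  | zero => simp [extraction]
  | succ T ih =>
    have h1 := S.mul_dotProduct_self_le_supply_zero hγ ε x
    have h2 := mul_nonneg hε.le (dotProduct_self_nonneg x)
    have h3 := ih (S.next x 0)
    change 0 ≤ S.supply γ ε x 0 + S.extraction γ ε T (S.next x 0) 0
    linarith

/-- Switching off the input after the horizon can only increase the extracted supply. -/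
theorem extraction_le_cutoff (S : Realization n) {γ ε : ℝ} (hγ : 0 < γ) (hε : 0 < ε) {T T' : ℕ}
    (h : T ≤ T') (x : n → ℝ) (w : ℕ → ℝ) :
    S.extraction γ ε T x w ≤ S.extraction γ ε T' x (cutoff T w) := by
  induction T generalizing T' x w with
  | zero =>
    have : cutoff 0 w = 0 := by funext k; simp [cutoff]
    rw [this]
    -- With zero input the supply is nonnegative, so the extra steps cost nothing. This is what
    -- allows two extractions to be compared on a common horizon.
    exact S.extraction_zero_nonneg hγ hε T' x
  | succ T ih =>
    obtain ⟨T', rfl⟩ : ∃ T'', T' = T'' + 1 := ⟨T' - 1, by omega⟩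
    have h1 := ih (T' := T') (by omega) (S.next x (w 0)) fun k => w (k + 1)
    have h2 : (fun k => cutoff (T + 1) w (k + 1)) = cutoff T fun k => w (k + 1) := by
      funext k; simp [cutoff]
    have h3 : cutoff (T + 1) w 0 = w 0 := by simp [cutoff]
    simp only [extraction, h2, h3]
    linarith

theorem state_succ' (S : Realization n) (x : n → ℝ) (w : ℕ → ℝ) (k : ℕ) :
    S.state x w (k + 1) = S.state (S.next x (w 0)) (fun k => w (k + 1)) k := by
  induction k with
  | zero => rfl
  | succ k ih => rw [state_succ, ih, state_succ]

theorem state_eq_add (S : Realization n) (x : n → ℝ) (w : ℕ → ℝ) (k : ℕ) :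
    S.state x w k = S.state 0 w k + S.state x 0 k := by
  induction k with
  | zero => simp [state]
  | succ k ih =>
    rw [state_succ, state_succ, state_succ, ih, ← next_add]
    simp

theorem extraction_eq_sum (S : Realization n) (γ ε : ℝ) (T : ℕ) (x : n → ℝ) (w : ℕ → ℝ) :
    S.extraction γ ε T x w = ∑ k ∈ Finset.range T, S.supply γ ε (S.state x w k) (w k) := by
  induction T generalizing x w with
  | zero => rfl
  | succ T ih =>
    rw [extraction, ih, Finset.sum_range_succ', add_comm]
    simp only [state_succ']
    rfl

variable [DecidableEq n]

/-- For a stable system with gain less than `γ` the extractable supply is finite. -/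
theorem IsStable.exists_extraction_le {S : Realization n} (hS : S.IsStable) {γ g : ℝ}
    (hγ : 0 < γ) (hg0 : 0 ≤ g) (hg : g < γ)
    (hgain : ∀ (w : ℕ → ℝ) (T : ℕ), ∑ k ∈ Finset.range T, S.output (S.state 0 w k) (w k) ^ 2
        ≤ g ^ 2 * ∑ k ∈ Finset.range T, w k ^ 2) :
    ∃ ε : ℝ, 0 < ε ∧ ∃ C : ℝ, ∀ (T : ℕ) (x : n → ℝ) (w : ℕ → ℝ),
      S.extraction γ ε T x w ≤ C * ‖x‖ ^ 2 := by
  obtain ⟨c, hc0, hc⟩ := hS.exists_sum_norm_sq_state_le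
  have hdot : ∀ x : n → ℝ, x ⬝ᵥ x ≤ Fintype.card n * ‖x‖ ^ 2 := by
    intro x
    rw [dotProduct, ← nsmul_eq_mul]
    refine Finset.sum_le_card_nsmul _ _ _ fun i _ => ?_
    rw [← sq, ← sq_abs]
    exact pow_le_pow_left₀ (abs_nonneg _) (norm_le_pi_norm x i) 2
  have hout : ∀ x : n → ℝ, S.output x 0 ^ 2 ≤ (∑ i, |S.C 0 i|) ^ 2 * ‖x‖ ^ 2 := by
    intro x
    rw [← mul_pow, ← sq_abs]
    refine pow_le_pow_left₀ (abs_nonneg _) ?_ 2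
    rw [output, mul_zero, add_zero, dotProduct, Finset.sum_mul]
    refine (Finset.abs_sum_le_sum_abs _ _).trans (Finset.sum_le_sum fun i _ => ?_)
    rw [abs_mul]
    exact mul_le_mul_of_nonneg_left (norm_le_pi_norm x i) (abs_nonneg _)
  set q : ℝ := (∑ i, |S.C 0 i|) ^ 2
  set d : ℝ := (Fintype.card n : ℝ)
  have hd0 : 0 ≤ d := Nat.cast_nonneg _
  have hq0 : 0 ≤ q := sq_nonneg _
  set δ : ℝ := γ - g ^ 2 / γ with hδ
  have hδ0 : 0 < δ := by
    rw [hδ, sub_pos, div_lt_iff₀ hγ]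
    nlinarith
  -- The gap `δ` is split in two: half absorbs the cross term between forced and free responses
  -- (`η`), half the `ε` penalties on state and input.
  obtain ⟨η, hη0, hη⟩ : ∃ η : ℝ, 0 < η ∧ η * (g ^ 2 / γ) ≤ δ / 2 := by
    refine ⟨δ / 2 / (g ^ 2 / γ + 1), by positivity, ?_⟩
    rw [div_mul_eq_mul_div, div_le_iff₀ (by positivity)]
    have : 0 ≤ g ^ 2 / γ := by positivity
    nlinarith
  obtain ⟨ε, hε0, hε⟩ : ∃ ε : ℝ, 0 < ε ∧ ε * (d * c + 1) ≤ δ / 2 :=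
    ⟨δ / 2 / (d * c + 1), by positivity, by rw [div_mul_cancel₀ _ (by positivity)]⟩
  refine ⟨ε, hε0, (1 + η⁻¹) / γ * (q * c) + ε * (d * c), fun T x w => ?_⟩
  rw [extraction_eq_sum]
  set Ew := ∑ k ∈ Finset.range T, w k ^ 2
  have hEw : 0 ≤ Ew := Finset.sum_nonneg fun _ _ => sq_nonneg _
  have hy : ∑ k ∈ Finset.range T, S.output (S.state x w k) (w k) ^ 2
      ≤ (1 + η) * (g ^ 2 * Ew) + (1 + η⁻¹) * (q * (c * ‖x‖ ^ 2)) := by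
    have h1 : ∀ k, S.output (S.state x w k) (w k) ^ 2
        ≤ (1 + η) * S.output (S.state 0 w k) (w k) ^ 2
          + (1 + η⁻¹) * (q * ‖S.state x 0 k‖ ^ 2) := by
      intro k
      have h2 : S.output (S.state x w k) (w k)
          = S.output (S.state 0 w k) (w k) + S.output (S.state x 0 k) 0 := by
        rw [state_eq_add, ← output_add, add_zero]
      have h3 := mul_le_mul_of_nonneg_left (hout (S.state x 0 k))
        (by positivity : 0 ≤ 1 + η⁻¹)
      rw [h2]
      set a := S.output (S.state 0 w k) (w k)
      set b := S.output (S.state x 0 k) 0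
      have h4 : (1 + η) * a ^ 2 + (1 + η⁻¹) * b ^ 2 - (a + b) ^ 2 = (η * a - b) ^ 2 / η := by
        field_simp
        ring
      have h5 : 0 ≤ (η * a - b) ^ 2 / η := by positivity
      linarith
    have h6 := Finset.sum_le_sum fun k (_ : k ∈ Finset.range T) => h1 k
    rw [Finset.sum_add_distrib, ← Finset.mul_sum, ← Finset.mul_sum, ← Finset.mul_sum] at h6
    have h7 := hc x 0 T
    simp only [Pi.zero_apply, ne_eq, OfNat.ofNat_ne_zero, not_false_eq_true, zero_pow,
      Finset.sum_const_zero, add_zero] at h7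
    refine h6.trans ?_
    gcongr
    exact hgain w T
  have hx : ∑ k ∈ Finset.range T, S.state x w k ⬝ᵥ S.state x w k
      ≤ d * (c * (‖x‖ ^ 2 + Ew)) := by
    refine (Finset.sum_le_sum fun k _ => hdot _).trans ?_
    rw [← Finset.mul_sum]
    gcongr
    exact hc x w T
  have hsplit : ∑ k ∈ Finset.range T, S.supply γ ε (S.state x w k) (w k)
      = (∑ k ∈ Finset.range T, S.output (S.state x w k) (w k) ^ 2) / γ
        + ε * (∑ k ∈ Finset.range T, S.state x w k ⬝ᵥ S.state x w k) - (γ - ε) * Ew := by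
    simp only [supply, Finset.sum_sub_distrib, Finset.sum_add_distrib, Finset.sum_div,
      Finset.mul_sum, Ew]
  rw [hsplit]
  have hy' := div_le_div_of_nonneg_right hy hγ.le
  have hx' := mul_le_mul_of_nonneg_left hx hε0.le
  have h8 : ((1 + η) * (g ^ 2 * Ew) + (1 + η⁻¹) * (q * (c * ‖x‖ ^ 2))) / γ
      = (g ^ 2 / γ + η * (g ^ 2 / γ)) * Ew + (1 + η⁻¹) / γ * (q * c) * ‖x‖ ^ 2 := by
    ring
  -- The total coefficient of the input energy is at most `g² / γ + δ/2 + δ/2 - γ = 0`, so only the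
  -- `‖x‖²` terms remain.
  have h9 : (g ^ 2 / γ + η * (g ^ 2 / γ) + ε * (d * c + 1) - γ) * Ew ≤ 0 :=
    mul_nonpos_of_nonpos_of_nonneg (by rw [hδ] at hη hε; linarith) hEw
  linarith

/-- The strict bounded real lemma, necessity: a stable system with gain less than `γ` has a
quadratic storage function, the supremum of the extractable supply. -/
theorem IsStable.exists_posDef {S : Realization n} (hS : S.IsStable) {γ g : ℝ}
    (hγ : 0 < γ) (hg0 : 0 ≤ g) (hg : g < γ)
    (hgain : ∀ (w : ℕ → ℝ) (T : ℕ), ∑ k ∈ Finset.range T, S.output (S.state 0 w k) (w k) ^ 2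
        ≤ g ^ 2 * ∑ k ∈ Finset.range T, w k ^ 2) :
    ∃ P : Matrix n n ℝ, P.PosDef ∧ (-boundedRealMatrix S γ P).PosDef := by
  obtain ⟨ε, hε, C, hC⟩ := hS.exists_extraction_le hγ hg0 hg hgain
  set V : (n → ℝ) → ℝ := fun x => ⨆ p : ℕ × (ℕ → ℝ), S.extraction γ ε p.1 x p.2 with hV
  have le_V : ∀ T x w, S.extraction γ ε T x w ≤ V x := fun T x w =>
    le_ciSup (f := fun p : ℕ × (ℕ → ℝ) => S.extraction γ ε p.1 x p.2)
      ⟨C * ‖x‖ ^ 2, by rintro _ ⟨p, rfl⟩; exact hC _ _ _⟩ (T, w)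
  have V_le : ∀ x r, (∀ T w, S.extraction γ ε T x w ≤ r) → V x ≤ r := fun x r h =>
    ciSup_le fun p => h p.1 p.2
  have V_ge : ∀ x, ε * (x ⬝ᵥ x) ≤ V x := by
    intro x
    refine (S.mul_dotProduct_self_le_supply_zero hγ ε x).trans ?_
    simpa [extraction] using le_V 1 x 0
  have V_nonneg : ∀ x, 0 ≤ V x := fun x =>
    (mul_nonneg hε.le (dotProduct_self_nonneg x)).trans (V_ge x)
  have V_two : ∀ x, V ((2 : ℝ) • x) = 4 * V x := by
    intro x
    apply le_antisymm
    · refine V_le _ _ fun T w => ?_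
      have h := S.extraction_smul γ ε 2 T x ((2 : ℝ)⁻¹ • w)
      rw [smul_inv_smul₀ two_ne_zero] at h
      linarith [le_V T x ((2 : ℝ)⁻¹ • w)]
    · have : V x ≤ V ((2 : ℝ) • x) / 4 := V_le _ _ fun T w => by
        linarith [S.extraction_smul γ ε 2 T x w, le_V T ((2 : ℝ) • x) ((2 : ℝ) • w)]
      linarith
  -- Near-optimal inputs `a`, `b` for `x + y` and `x - y` yield the trial inputs `(a + b)/2` for `x`
  -- and `(a - b)/2` for `y`.
  have V_par_le : ∀ x y, V (x + y) + V (x - y) ≤ 2 * V x + 2 * V y := by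
    intro x y
    have h1 : ∀ T w T' w', S.extraction γ ε T (x + y) w + S.extraction γ ε T' (x - y) w'
        ≤ 2 * V x + 2 * V y := by
      intro T w T' w'
      have h2 := S.extraction_le_cutoff hγ hε (le_max_left T T') (x + y) w
      have h3 := S.extraction_le_cutoff hγ hε (le_max_right T T') (x - y) w'
      set a := cutoff T w
      set b := cutoff T' w'
      have h4 := S.extraction_parallelogram γ ε (max T T') x y
        ((2 : ℝ)⁻¹ • (a + b)) ((2 : ℝ)⁻¹ • (a - b))
      have h5 : (2 : ℝ)⁻¹ • (a + b) + (2 : ℝ)⁻¹ • (a - b) = a := by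
        ext k; simp only [Pi.add_apply, Pi.smul_apply, Pi.sub_apply, smul_eq_mul]; ring
      have h6 : (2 : ℝ)⁻¹ • (a + b) - (2 : ℝ)⁻¹ • (a - b) = b := by
        ext k; simp only [Pi.add_apply, Pi.smul_apply, Pi.sub_apply, smul_eq_mul]; ring
      rw [h5, h6] at h4
      linarith [le_V (max T T') x ((2 : ℝ)⁻¹ • (a + b)), le_V (max T T') y ((2 : ℝ)⁻¹ • (a - b))]
    have h7 : V (x + y) ≤ 2 * V x + 2 * V y - V (x - y) := V_le _ _ fun T w => by
      have : V (x - y) ≤ 2 * V x + 2 * V y - S.extraction γ ε T (x + y) w :=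
        V_le _ _ fun T' w' => by linarith [h1 T w T' w']
      linarith
    linarith
  have V_par : ∀ x y, V (x + y) + V (x - y) = 2 * V x + 2 * V y := by
    intro x y
    refine le_antisymm (V_par_le x y) ?_
    -- The reverse inequality is the same one at `x + y`, `x - y`, combined with `V (2x) = 4 V x`.
    have h := V_par_le (x + y) (x - y)
    rw [show x + y + (x - y) = (2 : ℝ) • x by rw [two_smul]; abel,
      show x + y - (x - y) = (2 : ℝ) • y by rw [two_smul]; abel, V_two, V_two] at h
    linarith
  obtain ⟨P, hPh, hP⟩ := exists_symm_matrix_of_parallelogram V V_nonneg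
    (fun x => V_le x _ fun T w => hC T x w) V_par
  have hpos : ∀ x : n → ℝ, x ≠ 0 → 0 < ε * (x ⬝ᵥ x) := fun x hx =>
    mul_pos hε (lt_of_le_of_ne (dotProduct_self_nonneg x)
      (Ne.symm (dotProduct_self_eq_zero.not.2 hx)))
  -- Bellman inequality: prepending `u` to any input from the successor state gives a competitor
  -- from `x`.
  have hdp : ∀ x u, S.supply γ ε x u + V (S.next x u) ≤ V x := by
    intro x u
    have : V (S.next x u) ≤ V x - S.supply γ ε x u := V_le _ _ fun T w => by
      have := le_V (T + 1) x fun k => Nat.casesOn k u w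
      have h' : S.extraction γ ε (T + 1) x (fun k => Nat.casesOn k u w)
        = S.supply γ ε x u + S.extraction γ ε T (S.next x u) w := rfl
      linarith
    linarith
  refine ⟨P, Matrix.PosDef.of_dotProduct_mulVec_pos hPh fun x hx => ?_,
    (S.posDef_neg_boundedRealMatrix_iff γ hPh).2 fun x u e hne => ?_⟩
  · rw [star_trivial, ← hP]
    exact (hpos x hx).trans_le (V_ge x)
  · rw [← hP, ← hP]
    have h1 := hdp x u
    simp only [supply] at h1
    -- Completing the square in `e` bounds the form by `-ε|x|² - εu² - (y - γe)²/γ`. When `x` and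
    -- `u` vanish so does `y`, and the last term `-γe²` gives strictness.
    have h2 : S.output x u ^ 2 / γ - 2 * e * S.output x u + γ * e ^ 2
        = (S.output x u - γ * e) ^ 2 / γ := by
      field_simp
      ring
    have h3 : 0 ≤ (S.output x u - γ * e) ^ 2 / γ := by positivity
    have h4 := mul_nonneg hε.le (dotProduct_self_nonneg x)
    have h5 : 0 ≤ ε * u ^ 2 := by positivity
    by_cases hx : x = 0
    · by_cases hu : u = 0
      · have he : e ≠ 0 := by tauto
        subst hx hu
        have h6 : S.output 0 0 = 0 := by simp [output]
        rw [h6] at h1 ⊢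
        have h7 : 0 < γ * e ^ 2 := by positivity
        have h8 : V (S.next 0 0) ≤ V 0 := by simpa using h1
        simp only [mul_zero, sub_zero, add_zero, zero_pow two_ne_zero]
        linarith
      · have h6 : 0 < ε * u ^ 2 := by positivity
        linarith
    · linarith [hpos x hx]

/-- The strict bounded real lemma for a stable realization. -/
theorem IsStable.hInfNorm_lt_iff {S : Realization n} (hS : S.IsStable) {γ : ℝ} (hγ : 0 < γ) :
    hInfNorm S.transferFunction < ENNReal.ofReal γ ↔
      ∃ P : Matrix n n ℝ, P.PosDef ∧ (-boundedRealMatrix S γ P).PosDef := by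
  rw [_root_.hInfNorm_lt_iff _ hγ]
  simp only [systemOutput_transferFunction]
  constructor
  · rintro ⟨g, hg0, hg, h⟩
    exact hS.exists_posDef hγ hg0 hg h
  · rintro ⟨P, hP, hM⟩
    exact S.exists_gain_lt_of_posDef hγ hP hM

end Realization

end Storage

/-! ### Affine dependence on the coefficients and on `P` -/

theorem exists_affineMap_of_add_smul {E F : Type*} [AddCommGroup E] [Module ℝ E] [AddCommGroup F]
    [Module ℝ F] (f : E → F) (hadd : ∀ x y, f (x + y) = f x + f y - f 0)
    (hsmul : ∀ (t : ℝ) x, f (t • x) = t • (f x - f 0) + f 0) :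
    ∃ φ : E →ᵃ[ℝ] F, ∀ x, φ x = f x :=
  ⟨{ toFun := f
     linear :=
      { toFun := fun x => f x - f 0
        map_add' := fun x y => by rw [hadd]; abel
        map_smul' := fun t x => by rw [hsmul]; simp }
     map_vadd' := fun x y => by
      simp only [vadd_eq_add, LinearMap.coe_mk, AddHom.coe_mk, hadd]; abel }, fun _ => rfl⟩

section Affine

variable {nW nK : Type*} {N : ℕ} (W : Realization nW) (K : Realization nK)

theorem errorRealization_C_add (α β : Fin (N + 1) → ℝ) :
    (errorRealization W K (α + β)).C = (errorRealization W K α).C + (errorRealization W K β).C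
      - (errorRealization W K 0).C := by
  ext i (j | j | j) <;>
  simp [errorRealization, firRealization, Matrix.mul_apply]
  ring

theorem errorRealization_C_smul (t : ℝ) (α : Fin (N + 1) → ℝ) :
    (errorRealization W K (t • α)).C
      = t • ((errorRealization W K α).C - (errorRealization W K 0).C)
        + (errorRealization W K 0).C := by
  ext i (j | j | j) <;>
  simp [errorRealization, firRealization, Matrix.mul_apply]
  ring

theorem errorRealization_D_add (α β : Fin (N + 1) → ℝ) :
    (errorRealization W K (α + β)).D = (errorRealization W K α).D + (errorRealization W K β).D
      - (errorRealization W K (0 : Fin (N + 1) → ℝ)).D := by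
  ext i j
  simp [errorRealization, firRealization, Matrix.mul_apply]
  ring

theorem errorRealization_D_smul (t : ℝ) (α : Fin (N + 1) → ℝ) :
    (errorRealization W K (t • α)).D
      = t • ((errorRealization W K α).D - (errorRealization W K (0 : Fin (N + 1) → ℝ)).D)
        + (errorRealization W K (0 : Fin (N + 1) → ℝ)).D := by
  ext i j
  simp [errorRealization, firRealization, Matrix.mul_apply]
  ring

theorem errorRealization_A_eq (α β : Fin (N + 1) → ℝ) :
    (errorRealization W K α).A = (errorRealization W K β).A := rfl

theorem errorRealization_B_eq (α β : Fin (N + 1) → ℝ) :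
    (errorRealization W K α).B = (errorRealization W K β).B := rfl

variable [Fintype nW] [Fintype nK]

/-- `A` and `B` are fixed, so every product is linear in `P`. Subtracting the value at `(0, 0)`
removes the constants counted twice: `-γI` and the offsets of `C` and `D`. -/
theorem boundedRealMatrix_add (γ : ℝ) (P Q : Matrix (nW ⊕ (nK ⊕ Fin N)) (nW ⊕ (nK ⊕ Fin N)) ℝ)
    (α β : Fin (N + 1) → ℝ) :
    boundedRealMatrix (errorRealization W K (α + β)) γ (P + Q) =
      boundedRealMatrix (errorRealization W K α) γ P
        + boundedRealMatrix (errorRealization W K β) γ Q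
        - boundedRealMatrix (errorRealization W K 0) γ 0 := by
  simp only [boundedRealMatrix, errorRealization_C_add, errorRealization_D_add,
    errorRealization_A_eq W K _ 0, errorRealization_B_eq W K _ 0, Matrix.mul_add, Matrix.add_mul,
    Matrix.mul_zero, Matrix.zero_mul]
  generalize errorRealization W K (0 : Fin (N + 1) → ℝ) = S₀
  ext (i | i | i) (j | j | j) <;> simp <;> ring

theorem boundedRealMatrix_smul (γ t : ℝ) (P : Matrix (nW ⊕ (nK ⊕ Fin N)) (nW ⊕ (nK ⊕ Fin N)) ℝ)
    (α : Fin (N + 1) → ℝ) :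
    boundedRealMatrix (errorRealization W K (t • α)) γ (t • P) =
      t • (boundedRealMatrix (errorRealization W K α) γ P
          - boundedRealMatrix (errorRealization W K 0) γ 0)
        + boundedRealMatrix (errorRealization W K 0) γ 0 := by
  simp only [boundedRealMatrix, errorRealization_C_smul, errorRealization_D_smul,
    errorRealization_A_eq W K _ 0, errorRealization_B_eq W K _ 0, Matrix.mul_smul, Matrix.smul_mul,
    Matrix.mul_zero, Matrix.zero_mul]
  generalize errorRealization W K (0 : Fin (N + 1) → ℝ) = S₀
  ext (i | i | i) (j | j | j) <;> simp <;> ring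

end Affine

end

theorem mainTheorem3 {nW nK : Type*} [Fintype nW] [DecidableEq nW] [Fintype nK] [DecidableEq nK]
    (N : ℕ) (W : Realization nW) (K : Realization nK) (hW : W.IsStable) (hK : K.IsStable) :
    -- the given realizations of the FIR filter and of the error system are realizations
    (∀ α : Fin (N + 1) → ℝ, (firRealization α).transferFunction = firFilter α ∧
      (errorRealization W K α).transferFunction = errorTransfer W K α) ∧
    -- the coefficients enter only through `C` and `D`, and affinely
    (∀ α β : Fin (N + 1) → ℝ, (errorRealization W K α).A = (errorRealization W K β).A ∧
      (errorRealization W K α).B = (errorRealization W K β).B) ∧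
    (∃ F : (Fin (N + 1) → ℝ) →ᵃ[ℝ] Matrix (Fin 1) (nW ⊕ (nK ⊕ Fin N)) ℝ,
      ∀ α, F α = (errorRealization W K α).C) ∧
    (∃ F : (Fin (N + 1) → ℝ) →ᵃ[ℝ] Matrix (Fin 1) (Fin 1) ℝ,
      ∀ α, F α = (errorRealization W K α).D) ∧
    ∀ γ : ℝ, 0 < γ →
      -- the norm bound is equivalent to feasibility of the matrix inequality
      (∀ α : Fin (N + 1) → ℝ, hInfNorm (errorTransfer W K α) < ENNReal.ofReal γ ↔
        ∃ P : Matrix (nW ⊕ (nK ⊕ Fin N)) (nW ⊕ (nK ⊕ Fin N)) ℝ, P.PosDef ∧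
          (-(boundedRealMatrix (errorRealization W K α) γ P)).PosDef) ∧
      -- the matrix inequality is jointly affine in `(P, α)`
      ∃ F : (Matrix (nW ⊕ (nK ⊕ Fin N)) (nW ⊕ (nK ⊕ Fin N)) ℝ × (Fin (N + 1) → ℝ)) →ᵃ[ℝ]
          Matrix ((nW ⊕ (nK ⊕ Fin N)) ⊕ (Fin 1 ⊕ Fin 1))
            ((nW ⊕ (nK ⊕ Fin N)) ⊕ (Fin 1 ⊕ Fin 1)) ℝ,
        ∀ P α, F (P, α) = boundedRealMatrix (errorRealization W K α) γ P := by
  refine ⟨fun α => ⟨firRealization_transferFunction α, errorRealization_transferFunction W K α⟩,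
    fun α β => ⟨rfl, rfl⟩,
    exists_affineMap_of_add_smul _ (errorRealization_C_add W K) (errorRealization_C_smul W K),
    exists_affineMap_of_add_smul _ (errorRealization_D_add W K) (errorRealization_D_smul W K),
    fun γ hγ => ⟨fun α => ?_, ?_⟩⟩
  · rw [← errorRealization_transferFunction]
    exact (errorRealization_isStable hW hK α).hInfNorm_lt_iff hγ
  · obtain ⟨F, hF⟩ := exists_affineMap_of_add_smul
      (fun p : Matrix (nW ⊕ (nK ⊕ Fin N)) (nW ⊕ (nK ⊕ Fin N)) ℝ × (Fin (N + 1) → ℝ) =>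
        boundedRealMatrix (errorRealization W K p.2) γ p.1)
      (fun p q => boundedRealMatrix_add W K γ p.1 q.1 p.2 q.2)
      (fun t p => boundedRealMatrix_smul W K γ t p.1 p.2)
    exact ⟨F, fun P α => hF (P, α)⟩
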